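/- Let $n\ge 2$ and let $P=P_1P_2\cdots P_{2n}$ be a non-degenerate (strictly) convex polygon in $\mathbb{R}^2$ that is symmetric, $P_{i+n}=-P_i$, with vertices in counter-clockwise order and indices taken modulo $2n$. Write $[v,w]$ for the determinant with columns $v,w$, $\Delta_i L=L_{i+1}-L_i$ and $\nabla_i L=L_i-L_{i-1}$. Let $Q=Q_1\cdots Q_{2n}$ be the dual polygon, i.e. the only polygon with $[P_i,Q_i]=1$ and $[\Delta_iP,Q_i]=[P_{i+1},\Delta_iQ]=0$ for all $i$, and put $\alpha_i=1/[Q_i,Q_{i+1}]$, $\beta_i=1/[P_i,P_{i+1}]$. Let $T_P$ be the linear operator on $2n$-periodic real sequences given by $$(T_Pr)_i=-\beta_i\nabla_i(\alpha_i\Delta_i r),$$ and for $\lambda\in\mathbb{R}$ let $H_\lambda=S_{n+1}(\lambda)S_n(\lambda)\cdots S_2(\lambda)$ be the half-turn transform, where $$S_k(\lambda)=\begin{pmatrix}0&1\\-\frac{\alpha_{k-1}}{\alpha_k}&1+\frac{\alpha_{k-1}}{\alpha_k}-\frac{\lambda}{\alpha_k\beta_k}\end{pmatrix}.$$ The $2n$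 eigenvalues of $T_P$, counted with multiplicity, are all real. List them in non-decreasing order as $$\lambda_0,\ \lambda_1^1,\ \lambda_1^2,\ \lambda_2^1,\ \lambda_2^2,\ \dots,\ \lambda_{n-1}^1,\ \lambda_{n-1}^2,\ \lambda_n,$$ and write also $\lambda_0^2=\lambda_0$ and $\lambda_n^1=\lambda_n$. Then: a) For every $0\le k\le n-1$ we have $\lambda_k^2<\lambda_{k+1}^1$. There is a continuous bijection $\theta:[\lambda_k^2,\lambda_{k+1}^1]\to[0,\pi]$, mapping $(\lambda_k^2,\lambda_{k+1}^1)$ into $(0,\pi)$, such that for every $\lambda\in[\lambda_k^2,\lambda_{k+1}^1]$ the complex eigenvalues of $H_\lambda$ are exactly $e^{i\theta(\lambda)}$ and $e^{-i\theta(\lambda)}$; in particular, for $\lambda_k^2<\lambda<\lambda_{k+1}^1$, $H_\lambda$ has two distinct non-real eigenvalues $e^{\pm i\theta}$. Moreover the eigenvalues go through all values in the complex unit circle exactly once: for every $z\in\mathbb{C}$ with $|z|=1$ there is exactly one $\lambda\in[\lambda_k^2,\lambda_{k+1}^1]$ such that $z$ is an eigenvalue of $H_\lambda$. b) If $\lambda<0$,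 or $\lambda_k^1<\lambda<\lambda_k^2$ for some $1\le k\le n-1$, then $H_\lambda$ has two distinct real eigenvalues $\mu$ and $\mu^{-1}$. -/

import Mathlib

noncomputable section

/-- The determinant `[v, w]` of the matrix with columns `v`, `w` in the plane. -/
def planeDet (v w : ℝ × ℝ) : ℝ := v.1 * w.2 - v.2 * w.1

/-- A symmetric non-degenerate convex polygon with `2 n` vertices in the plane, the vertices being
listed counter-clockwise and indexed modulo `2 n`. Convexity: all the other vertices lie strictly to
the left of the oriented line through any two consecutive vertices. -/
structure PolygonalBall (n : ℕ) where
  vertex : ZMod (2 * n) → ℝ × ℝ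
  two_le : 2 ≤ n
  symm' : ∀ i, vertex (i + n) = -vertex i
  convex' : ∀ i j, j ≠ i → j ≠ i + 1 → 0 < planeDet (vertex (i + 1) - vertex i) (vertex j - vertex i)

namespace PolygonalBall

variable {n : ℕ} (P : PolygonalBall n)

/-- `β i = 1 / [P i, P (i + 1)]`. -/
def beta (i : ZMod (2 * n)) : ℝ := 1 / planeDet (P.vertex i) (P.vertex (i + 1))

/-- The vertices `Q i` of the dual polygon. -/
def dual (i : ZMod (2 * n)) : ℝ × ℝ := P.beta i • (P.vertex (i + 1) - P.vertex i)

/-- `α i = 1 / [Q i, Q (i + 1)]`. -/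
def alpha (i : ZMod (2 * n)) : ℝ := 1 / planeDet (P.dual i) (P.dual (i + 1))

/-- The origin lies strictly to the left of every side. -/
theorem planeDet_vertex_pos (i : ZMod (2 * n)) :
    0 < planeDet (P.vertex i) (P.vertex (i + 1)) := by
  have h2 := P.two_le
  have key : ∀ m : ℕ, 0 < m → m < 2 * n → ((m : ℕ) : ZMod (2 * n)) ≠ 0 := by
    intro m h0 h1 h
    rw [ZMod.natCast_eq_zero_iff] at h
    exact absurd (Nat.le_of_dvd h0 h) (by omega)
  have hn : i + (n : ZMod (2 * n)) ≠ i := by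
    intro h
    exact key n (by omega) (by omega) (by simpa using h)
  have hn1 : i + (n : ZMod (2 * n)) ≠ i + 1 := by
    intro h
    have h' : (n : ZMod (2 * n)) = 1 := add_left_cancel h
    apply key (n - 1) (by omega) (by omega)
    rw [Nat.cast_sub (by omega), h']
    simp
  have h := P.convex' i (i + n) hn hn1
  rw [P.symm'] at h
  simp only [planeDet, Prod.fst_sub, Prod.snd_sub, Prod.fst_neg, Prod.snd_neg] at h ⊢
  linarith

/-- The dual polygon is the only polygon `Q` with `[P i, Q i] = 1`, `[Δ i P, Q i] = 0` and
`[P (i + 1), Δ i Q] = 0` for all `i`. -/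
theorem eq_dual_iff (Q : ZMod (2 * n) → ℝ × ℝ) :
    Q = P.dual ↔ ∀ i, planeDet (P.vertex i) (Q i) = 1 ∧
      planeDet (P.vertex (i + 1) - P.vertex i) (Q i) = 0 ∧
      planeDet (P.vertex (i + 1)) (Q (i + 1) - Q i) = 0 := by
  have hne : ∀ i, planeDet (P.vertex i) (P.vertex (i + 1)) ≠ 0 :=
    fun i => (P.planeDet_vertex_pos i).ne'
  constructor
  · rintro rfl
    have h1 : ∀ i, planeDet (P.vertex i) (P.dual i) = 1 := by
      intro i
      have h := hne i
      have hb : P.beta i * planeDet (P.vertex i) (P.vertex (i + 1)) = 1 := by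
        rw [beta, one_div_mul_cancel h]
      simp only [dual, planeDet, Prod.smul_fst, Prod.smul_snd, Prod.fst_sub, Prod.snd_sub,
        smul_eq_mul] at hb ⊢
      linear_combination hb
    have h2 : ∀ i, planeDet (P.vertex (i + 1) - P.vertex i) (P.dual i) = 0 := by
      intro i
      simp only [dual, planeDet, Prod.smul_fst, Prod.smul_snd, smul_eq_mul]
      ring
    intro i
    refine ⟨h1 i, h2 i, ?_⟩
    have a := h1 i
    have b := h2 i
    have c := h1 (i + 1)
    simp only [planeDet, Prod.fst_sub, Prod.snd_sub] at a b c ⊢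
    linear_combination c - a - b
  · intro h
    funext i
    obtain ⟨a, b, -⟩ := h i
    have hd := hne i
    have hb : P.beta i * planeDet (P.vertex i) (P.vertex (i + 1)) = 1 := by
      rw [beta, one_div_mul_cancel hd]
    simp only [planeDet, Prod.fst_sub, Prod.snd_sub] at a b hb
    ext
    · simp only [dual, Prod.smul_fst, Prod.fst_sub, smul_eq_mul]
      linear_combination (-(Q i).1) * hb + P.beta i * ((P.vertex (i + 1)).1 - (P.vertex i).1) * a
        - P.beta i * (P.vertex i).1 * b
    · simp only [dual, Prod.smul_snd, Prod.snd_sub, smul_eq_mul]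
      linear_combination (-(Q i).2) * hb + P.beta i * ((P.vertex (i + 1)).2 - (P.vertex i).2) * a
        - P.beta i * (P.vertex i).2 * b

/-- The evolute transform `s i = α i * Δ i r` on `2 n`-periodic sequences of curvature radii. -/
def evolute : (ZMod (2 * n) → ℝ) →ₗ[ℝ] (ZMod (2 * n) → ℝ) where
  toFun r := fun i => P.alpha i * (r (i + 1) - r i)
  map_add' r s := by funext i; simp only [Pi.add_apply]; ring
  map_smul' c r := by
    funext i; simp only [Pi.smul_apply, smul_eq_mul, RingHom.id_apply]; ring

/-- The second evolute transform `t i = -β i * ∇ i s`. -/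
def evoluteDual : (ZMod (2 * n) → ℝ) →ₗ[ℝ] (ZMod (2 * n) → ℝ) where
  toFun s := fun i => -P.beta i * (s i - s (i - 1))
  map_add' r s := by funext i; simp only [Pi.add_apply]; ring
  map_smul' c r := by
    funext i; simp only [Pi.smul_apply, smul_eq_mul, RingHom.id_apply]; ring

/-- The double evolute transform `T_P`. -/
def doubleEvolute : (ZMod (2 * n) → ℝ) →ₗ[ℝ] (ZMod (2 * n) → ℝ) :=
  P.evoluteDual ∘ₗ P.evolute

/-- The real eigenvalues of `T_P`, with multiplicity, in non-decreasing order. -/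
def eigenvalueList [NeZero n] : List ℝ :=
  P.doubleEvolute.charpoly.roots.sort (· ≤ ·)

/-- `λ_k^1` for `1 ≤ k ≤ n`, where `λ_n^1` stands for `λ_n`: the ordered list of eigenvalues is
`λ_0, λ_1^1, λ_1^2, …, λ_{n-1}^1, λ_{n-1}^2, λ_n`. -/
def lambdaOne [NeZero n] (k : ℕ) : ℝ := P.eigenvalueList.getD (2 * k - 1) 0

/-- `λ_k^2` for `0 ≤ k ≤ n - 1`, where `λ_0^2` stands for `λ_0`. -/
def lambdaTwo [NeZero n] (k : ℕ) : ℝ := P.eigenvalueList.getD (2 * k) 0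

/-- The matrix `S_k(l)` that takes `(r_{k-1}, r_k)` to `(r_k, r_{k+1})` for the solutions of
`T_P r = l r`. -/
def stepMatrix (l : ℝ) (k : ZMod (2 * n)) : Matrix (Fin 2) (Fin 2) ℝ :=
  !![0, 1;
     -(P.alpha (k - 1) / P.alpha k),
       1 + P.alpha (k - 1) / P.alpha k - l / (P.alpha k * P.beta k)]

/-- The product `S_{m+1}(l) * ⋯ * S_3(l) * S_2(l)`, which takes `(r_1, r_2)` to
`(r_{m+1}, r_{m+2})`. -/
def transferMatrix (l : ℝ) : ℕ → Matrix (Fin 2) (Fin 2) ℝ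
  | 0 => 1
  | m + 1 => P.stepMatrix l ((m + 2 : ℕ) : ZMod (2 * n)) * transferMatrix l m

/-- The half-turn transform `H_l = S_{n+1}(l) * ⋯ * S_2(l)`. -/
def halfTurn (l : ℝ) : Matrix (Fin 2) (Fin 2) ℝ := P.transferMatrix l n

/-- The real number `μ` is an eigenvalue of `H_l`. -/
def IsRealEigenvalue (l μ : ℝ) : Prop :=
  Module.End.HasEigenvalue (Matrix.toLin' (P.halfTurn l)) μ

/-- The complex number `z` is an eigenvalue of `H_l`. -/
def IsComplexEigenvalue (l : ℝ) (z : ℂ) : Prop :=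
  Module.End.HasEigenvalue (Matrix.toLin' ((P.halfTurn l).map (algebraMap ℝ ℂ))) z

end PolygonalBall

end

/-! Everything is read off from the discriminant `D(l) = tr H_l`, a polynomial of degree `n`. Since
`det H_l = 1`, the eigenvalues of `H_l` are the roots of `z² - D(l) z + 1`: they lie on the unit
circle when `|D| ≤ 2` and are real, distinct and mutually inverse when `D² > 4`.

A `2n`-periodic solution of `T_P r = l r` is fixed by `H_l²`, and `det (H_l² - 1) = 4 - D(l)²`, so
eigenvalues of `T_P` are zeros of `D² - 4`. A double eigenvalue forces `H_l = ±1`, and then `D' =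
0`. As `T_P` is self-adjoint for the weights `1/β` and its eigenspaces have dimension at most 2, its
characteristic polynomial divides `D² - 4`; equal degrees make them proportional
(`discriminant_sq_sub_eq`).

Hence `D - 2` and `D + 2` are real-rooted, and the strict Laguerre inequality applies to both. It
excludes critical points of `D` where `|D| < 2`, so `D` is injective on each band, and it excludes
bands reduced to a point (`IsDiscriminant.lt_succ`). Then `θ = arccos (D / 2)` gives (a), while (b)
follows from the sign of `D² - 4` between consecutive zeros. -/

open Polynomial

/-! ### Laguerre's inequality and critical points of real-rooted polynomials. -/

namespace Polynomial

/-- Off the zeros, `(q'² - q q'') / q² = -(q'/q)' = ∑ 1/(x - a)²`. The induction clears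
denominators; its weak half needs no nonvanishing and is all that the inductive step uses,
strictness coming from the new term `g(x)²`. -/
theorem laguerre_multiset (s : Multiset ℝ) (x : ℝ) :
    let q := (s.map fun a => X - C a).prod
    0 ≤ (derivative q).eval x ^ 2 - q.eval x * (derivative (derivative q)).eval x ∧
      (s ≠ 0 → q.eval x ≠ 0 →
        0 < (derivative q).eval x ^ 2 - q.eval x * (derivative (derivative q)).eval x) := by
  induction s using Multiset.induction_on with
  | empty => simp
  | cons a s ih =>
    obtain ⟨h0, -⟩ := ih
    set g := (s.map fun a => X - C a).prod
    have key : (derivative ((X - C a) * g)).eval x ^ 2 -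
        ((X - C a) * g).eval x * (derivative (derivative ((X - C a) * g))).eval x =
        g.eval x ^ 2 + (x - a) ^ 2 * ((derivative g).eval x ^ 2 -
          g.eval x * (derivative (derivative g)).eval x) := by
      simp only [derivative_mul, derivative_sub, derivative_X, derivative_C, derivative_add,
        eval_mul, eval_add, eval_sub, eval_X, eval_C, eval_one, eval_zero, derivative_one, sub_zero]
      ring
    simp only [Multiset.map_cons, Multiset.prod_cons]
    rw [key]
    refine ⟨by positivity, fun _ hx => ?_⟩
    have hg : g.eval x ≠ 0 := by
      intro h
      apply hx
      exact (eval_mul ..).trans (mul_eq_zero_of_right _ h)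
    positivity

/-- The strict Laguerre inequality for a real-rooted polynomial. -/
theorem Splits.laguerre {p : ℝ[X]} (hp : p.Splits) (hd : p.natDegree ≠ 0) {x : ℝ}
    (hx : p.eval x ≠ 0) :
    p.eval x * (derivative (derivative p)).eval x < (derivative p).eval x ^ 2 := by
  have h := (laguerre_multiset p.roots x).2 (hp.roots_ne_zero hd)
  have hq := hp.eq_prod_roots
  set q := (p.roots.map fun a => X - C a).prod
  have hp0 : p.leadingCoeff ≠ 0 := by
    intro h0
    rw [h0] at hq
    apply hx
    rw [hq]
    simp
  rw [hq] at hx ⊢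
  simp only [derivative_mul, derivative_C, zero_mul, zero_add, eval_mul, eval_C] at hx ⊢
  have := h (right_ne_zero_of_mul hx)
  have h2 : 0 < p.leadingCoeff ^ 2 := by positivity
  nlinarith

/-- At a critical point, Laguerre for `D - 2` and for `D + 2` gives `(D - 2) D'' < 0` and `(D + 2)
D'' < 0`, although the two factors have opposite signs. -/
theorem Splits.derivative_eval_ne_zero_of_abs_lt_two {D : ℝ[X]} (h1 : (D - C 2).Splits)
    (h2 : (D + C 2).Splits) (hd : D.natDegree ≠ 0) {x : ℝ} (hx : |D.eval x| < 2) :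
    (derivative D).eval x ≠ 0 := by
  intro h0
  obtain ⟨ha, hb⟩ := abs_lt.1 hx
  have e1 := h1.laguerre (x := x) (by rwa [natDegree_sub_C]) (by simp; linarith)
  have e2 := h2.laguerre (x := x) (by rwa [natDegree_add_C]) (by simp; linarith)
  simp only [derivative_sub, derivative_add, derivative_C, eval_sub, eval_add, eval_C, sub_zero,
    add_zero, h0] at e1 e2
  nlinarith

/-- Where one of `D ∓ 2` vanishes, the other equals `±4` with the sign of `D`, and Laguerre applies
to it. So at such a critical point `D² - 4` has a strict local maximum. -/
theorem Splits.eval_mul_derivative_derivative_neg {D : ℝ[X]} (h1 : (D - C 2).Splits)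
    (h2 : (D + C 2).Splits) (hd : D.natDegree ≠ 0) {x : ℝ} (hx : D.eval x ^ 2 = 4)
    (h0 : (derivative D).eval x = 0) :
    D.eval x * (derivative (derivative D)).eval x < 0 := by
  have : (D.eval x - 2) * (D.eval x + 2) = 0 := by linarith
  rcases mul_eq_zero.1 this with h | h
  · have e2 := h2.laguerre (x := x) (by rwa [natDegree_add_C]) (by simp; linarith)
    simp only [derivative_add, derivative_C, eval_add, eval_C, add_zero, h0] at e2
    nlinarith
  · have e1 := h1.laguerre (x := x) (by rwa [natDegree_sub_C]) (by simp; linarith)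
    simp only [derivative_sub, derivative_C, eval_sub, eval_C, sub_zero, h0] at e1
    nlinarith

end Polynomial

/-! ### Bands and gaps of an abstract discriminant. -/

theorem prod_sub_sign {N j : ℕ} (hj : j ≤ N) {x : ℕ → ℝ} {t : ℝ} (hl : ∀ i < j, x i < t)
    (hr : ∀ i, j ≤ i → i < N → t < x i) :
    0 < (-1) ^ (N - j) * ∏ i ∈ Finset.range N, (t - x i) := by
  rw [← Finset.prod_range_mul_prod_Ico _ hj, mul_left_comm]
  refine mul_pos (Finset.prod_pos fun i hi => sub_pos.2 (hl i (Finset.mem_range.1 hi))) ?_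
  rw [← Nat.card_Ico, ← Finset.prod_const, ← Finset.prod_mul_distrib]
  refine Finset.prod_pos fun i hi => ?_
  have := hr i (Finset.mem_Ico.1 hi).1 (Finset.mem_Ico.1 hi).2
  linarith

/-- A real polynomial `D` such that `D - 2` and `D + 2` have only real zeros, together with the
ordered list `x 0 ≤ x 1 ≤ ⋯` of the zeros of `D ^ 2 - 4`. -/
structure IsDiscriminant (n : ℕ) (D : ℝ[X]) (c : ℝ) (x : ℕ → ℝ) : Prop where
  natDegree_ne_zero : D.natDegree ≠ 0
  splits_sub : (D - C 2).Splits
  splits_add : (D + C 2).Splits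
  pos : 0 < c
  mono : ∀ i j, i ≤ j → j < 2 * n → x i ≤ x j
  eq_prod : D ^ 2 - C 4 = C c * ∏ i ∈ Finset.range (2 * n), (X - C (x i))

namespace IsDiscriminant

variable {n : ℕ} {D : ℝ[X]} {c : ℝ} {x : ℕ → ℝ}

theorem eval_sq_sub (h : IsDiscriminant n D c x) (t : ℝ) :
    D.eval t ^ 2 - 4 = c * ∏ i ∈ Finset.range (2 * n), (t - x i) := by
  have := congrArg (eval t) h.eq_prod
  simpa [eval_prod] using this

theorem sq_eq_four (h : IsDiscriminant n D c x) {i : ℕ} (hi : i < 2 * n) :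
    D.eval (x i) ^ 2 = 4 := by
  have := h.eval_sq_sub (x i)
  rw [Finset.prod_eq_zero (Finset.mem_range.2 hi) (sub_self _)] at this
  linarith

theorem sign (h : IsDiscriminant n D c x) {j : ℕ} (hj : j ≤ 2 * n) {t : ℝ}
    (hl : ∀ i < j, x i < t) (hr : ∀ i, j ≤ i → i < 2 * n → t < x i) :
    0 < (-1) ^ (2 * n - j) * (D.eval t ^ 2 - 4) := by
  rw [h.eval_sq_sub, mul_left_comm]
  exact mul_pos h.pos (prod_sub_sign hj hl hr)

theorem abs_lt_two (h : IsDiscriminant n D c x) {k : ℕ} (hk : k < n) {t : ℝ}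
    (hl : x (2 * k) < t) (hr : t < x (2 * k + 1)) : |D.eval t| < 2 := by
  have := h.sign (j := 2 * k + 1) (by omega) (t := t)
    (fun i hi => (h.mono i (2 * k) (by omega) (by omega)).trans_lt hl)
    (fun i hi hi' => hr.trans_le (h.mono _ _ hi hi'))
  rw [Odd.neg_one_pow ⟨n - k - 1, by omega⟩] at this
  rw [← sq_lt_sq₀ (abs_nonneg _) (by norm_num), sq_abs]
  linarith

theorem four_lt_eval_sq_of_lt (h : IsDiscriminant n D c x) {t : ℝ} (ht : ∀ i < 2 * n, t < x i) :
    4 < D.eval t ^ 2 := by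
  have := h.sign (j := 0) (by omega) (t := t) (by simp) (fun i _ hi => ht i hi)
  rw [Even.neg_one_pow ⟨n, by omega⟩] at this
  linarith

theorem four_lt_eval_sq (h : IsDiscriminant n D c x) {k : ℕ} (hk : k < n) (hk1 : 1 ≤ k) {t : ℝ}
    (hl : x (2 * k - 1) < t) (hr : t < x (2 * k)) : 4 < D.eval t ^ 2 := by
  have := h.sign (j := 2 * k) (by omega) (t := t)
    (fun i hi => (h.mono i (2 * k - 1) (by omega) (by omega)).trans_lt hl)
    (fun i hi hi' => hr.trans_le (h.mono _ _ hi hi'))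
  rw [Even.neg_one_pow ⟨n - k, by omega⟩] at this
  linarith

/-- The end points of a stability interval are different. -/
theorem lt_succ (h : IsDiscriminant n D c x) {k : ℕ} (hk : k < n) :
    x (2 * k) < x (2 * k + 1) := by
  refine lt_of_le_of_ne (h.mono _ _ (by omega) (by omega)) fun heq => ?_
  set t := x (2 * k) with ht
  set G : ℝ[X] := (∏ i ∈ Finset.range (2 * k), (X - C (x i))) *
    ∏ i ∈ Finset.Ico (2 * k + 2) (2 * n), (X - C (x i)) with hG
  -- If the end points coincide, an even number `2n - 2k - 2` of listed zeros follows the pair, so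
  -- `G(t) ≥ 0`. Differentiating twice at `t` yields `D D'' = c G(t) ≥ 0`, against the strict local
  -- maximum forced by Laguerre.
  have hF : D ^ 2 - C 4 = C c * ((X - C t) ^ 2 * G) := by
    rw [h.eq_prod, ← Finset.prod_range_mul_prod_Ico _ (show 2 * k + 2 ≤ 2 * n by omega),
      Finset.prod_range_succ, Finset.prod_range_succ, ← heq, ← ht, hG]
    ring
  have hG0 : 0 ≤ G.eval t := by
    rw [hG, eval_mul, eval_prod, eval_prod]
    refine mul_nonneg (Finset.prod_nonneg fun i hi => ?_) ?_
    · have := h.mono i (2 * k) (Finset.mem_range.1 hi).le (by omega)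
      simp only [eval_sub, eval_X, eval_C]
      linarith
    · rw [Finset.prod_congr rfl (g := fun i => (-1) * (x i - t)) (fun i _ => by simp),
        Finset.prod_mul_distrib, Finset.prod_const, Nat.card_Ico,
        Even.neg_one_pow ⟨n - k - 1, by omega⟩, one_mul]
      refine Finset.prod_nonneg fun i hi => sub_nonneg.2 ?_
      have hi' := Finset.mem_Ico.1 hi
      exact h.mono _ _ (by omega) hi'.2
  have h4 : D.eval t ^ 2 = 4 := h.sq_eq_four (by omega)
  have hd1 := congrArg (fun p => (derivative p).eval t) hF
  have hd2 := congrArg (fun p => (derivative (derivative p)).eval t) hF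
  simp only [pow_two, derivative_mul, derivative_sub, derivative_X, derivative_C, derivative_add,
    eval_mul, eval_add, eval_sub, eval_X, eval_C, eval_one, sub_self, sub_zero, zero_mul, mul_zero, add_zero, zero_add, one_mul,
    mul_one] at hd1 hd2
  have hD : (derivative D).eval t = 0 := by
    have : D.eval t ≠ 0 := by rintro h0; rw [h0] at h4; norm_num at h4
    have : D.eval t * (derivative D).eval t = 0 := by linarith
    simp_all
  have := h.splits_sub.eval_mul_derivative_derivative_neg h.splits_add h.natDegree_ne_zero h4 hD
  rw [hD] at hd2
  have := mul_nonneg h.pos.le hG0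
  linarith

theorem injOn (h : IsDiscriminant n D c x) {k : ℕ} (hk : k < n) :
    Set.InjOn (fun t => D.eval t) (Set.Icc (x (2 * k)) (x (2 * k + 1))) := by
  have key : ∀ u ∈ Set.Icc (x (2 * k)) (x (2 * k + 1)),
      ∀ v ∈ Set.Icc (x (2 * k)) (x (2 * k + 1)), u < v → D.eval u ≠ D.eval v := by
    intro u hu v hv huv heq
    obtain ⟨w, hw, hw0⟩ := exists_deriv_eq_zero huv D.continuous.continuousOn heq
    rw [Polynomial.deriv] at hw0
    exact h.splits_sub.derivative_eval_ne_zero_of_abs_lt_two h.splits_add h.natDegree_ne_zero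
      (h.abs_lt_two hk (hu.1.trans_lt hw.1) (hw.2.trans_le hv.2)) hw0
  intro u hu v hv heq
  by_contra hne
  rcases lt_or_gt_of_ne hne with hlt | hlt
  · exact key u hu v hv hlt heq
  · exact key v hv u hu hlt heq.symm

theorem mapsTo (h : IsDiscriminant n D c x) {k : ℕ} (hk : k < n) :
    Set.MapsTo (fun t => D.eval t) (Set.Icc (x (2 * k)) (x (2 * k + 1))) (Set.Icc (-2) 2) := by
  intro t ht
  rw [Set.mem_Icc, ← abs_le]
  rcases ht.1.eq_or_lt with h0 | h0
  · rw [← h0, ← sq_le_sq₀ (abs_nonneg _) (by norm_num), sq_abs, h.sq_eq_four (by omega)]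
    norm_num
  rcases ht.2.eq_or_lt with h1 | h1
  · rw [h1, ← sq_le_sq₀ (abs_nonneg _) (by norm_num), sq_abs, h.sq_eq_four (by omega)]
    norm_num
  exact (h.abs_lt_two hk h0 h1).le

/-- Both end values are `±2`, and injectivity makes them different, so the intermediate value
theorem covers the whole interval. -/
theorem surjOn (h : IsDiscriminant n D c x) {k : ℕ} (hk : k < n) :
    Set.SurjOn (fun t => D.eval t) (Set.Icc (x (2 * k)) (x (2 * k + 1))) (Set.Icc (-2) 2) := by
  have hlt := h.lt_succ hk
  have hne : D.eval (x (2 * k)) ≠ D.eval (x (2 * k + 1)) := fun heq =>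
    hlt.ne (h.injOn hk ⟨le_rfl, hlt.le⟩ ⟨hlt.le, le_rfl⟩ heq)
  have e0 := h.sq_eq_four (i := 2 * k) (by omega)
  have e1 := h.sq_eq_four (i := 2 * k + 1) (by omega)
  have f0 : D.eval (x (2 * k)) = 2 ∨ D.eval (x (2 * k)) = -2 :=
    sq_eq_sq_iff_eq_or_eq_neg.1 (by linarith)
  have f1 : D.eval (x (2 * k + 1)) = 2 ∨ D.eval (x (2 * k + 1)) = -2 :=
    sq_eq_sq_iff_eq_or_eq_neg.1 (by linarith)
  have hc := D.continuous.continuousOn (s := Set.Icc (x (2 * k)) (x (2 * k + 1)))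
  rcases f0 with f0 | f0 <;> rcases f1 with f1 | f1
  · exact absurd (f0.trans f1.symm) hne
  · simpa only [f0, f1] using! intermediate_value_Icc' hlt.le hc
  · simpa only [f0, f1] using! intermediate_value_Icc hlt.le hc
  · exact absurd (f0.trans f1.symm) hne

theorem bijOn (h : IsDiscriminant n D c x) {k : ℕ} (hk : k < n) :
    Set.BijOn (fun t => D.eval t) (Set.Icc (x (2 * k)) (x (2 * k + 1))) (Set.Icc (-2) 2) :=
  ⟨h.mapsTo hk, h.injOn hk, h.surjOn hk⟩

end IsDiscriminant

/-! ### Positivity and half-turn periodicity of the coefficients. -/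

namespace PolygonalBall

variable {n : ℕ} (P : PolygonalBall n)

theorem natCast_ne_zero_of_lt {m : ℕ} (h0 : 0 < m) (h1 : m < 2 * n) :
    ((m : ℕ) : ZMod (2 * n)) ≠ 0 := by
  intro h
  rw [ZMod.natCast_eq_zero_iff] at h
  exact absurd (Nat.le_of_dvd h0 h) (by omega)

theorem beta_pos (i : ZMod (2 * n)) : 0 < P.beta i :=
  one_div_pos.2 (P.planeDet_vertex_pos i)

theorem alpha_pos (i : ZMod (2 * n)) : 0 < P.alpha i := by
  have h2 := P.two_le
  refine one_div_pos.2 ?_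
  have h := P.convex' i (i + 1 + 1)
    (fun h => natCast_ne_zero_of_lt (n := n) (m := 2) (by omega) (by omega) (by
      have : i + (1 + 1) = i := by rw [← add_assoc]; exact h
      have := add_eq_left.1 this
      push_cast
      rw [← this]
      norm_num))
    (fun h => natCast_ne_zero_of_lt (n := n) (m := 1) (by omega) (by omega) (by
      simpa using add_eq_left.1 h))
  -- `[Q_i, Q_{i+1}] = β_i β_{i+1} [Δ_i P, Δ_{i+1} P]`, and the last determinant is convexity at
  -- three consecutive vertices.
  have hb := mul_pos (mul_pos (P.beta_pos i) (P.beta_pos (i + 1))) h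
  simp only [dual, planeDet, Prod.smul_fst, Prod.smul_snd, Prod.fst_sub, Prod.snd_sub,
    smul_eq_mul] at hb ⊢
  linarith

theorem beta_add (i : ZMod (2 * n)) : P.beta (i + n) = P.beta i := by
  have : i + (n : ZMod (2 * n)) + 1 = i + 1 + n := by ring
  simp only [beta, this, P.symm', planeDet, Prod.fst_neg, Prod.snd_neg]
  ring_nf

theorem dual_add (i : ZMod (2 * n)) : P.dual (i + n) = -P.dual i := by
  have : i + (n : ZMod (2 * n)) + 1 = i + 1 + n := by ring
  simp only [dual, this, P.symm', P.beta_add]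
  rw [← smul_neg]
  congr 1
  abel

theorem alpha_add (i : ZMod (2 * n)) : P.alpha (i + n) = P.alpha i := by
  have : i + (n : ZMod (2 * n)) + 1 = i + 1 + n := by ring
  simp only [alpha, this, P.dual_add, planeDet, Prod.fst_neg, Prod.snd_neg]
  ring_nf

theorem doubleEvolute_apply (r : ZMod (2 * n) → ℝ) (i : ZMod (2 * n)) :
    P.doubleEvolute r i =
      -P.beta i * (P.alpha i * (r (i + 1) - r i) - P.alpha (i - 1) * (r i - r (i - 1))) := by
  simp [doubleEvolute, evoluteDual, evolute]

/-! ### Symmetry of the double evolute transform -/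

/-- Summation by parts. The resulting Dirichlet form is symmetric and nonnegative, which yields real
eigenvalues, semisimplicity and `l ≥ 0`. -/
theorem sum_doubleEvolute_mul [NeZero n] (r s : ZMod (2 * n) → ℝ) :
    ∑ i, P.doubleEvolute r i * s i / P.beta i =
      ∑ i, P.alpha i * (r (i + 1) - r i) * (s (i + 1) - s i) := by
  have h1 : ∀ i, P.doubleEvolute r i * s i / P.beta i =
      P.alpha (i - 1) * (r i - r (i - 1)) * s i - P.alpha i * (r (i + 1) - r i) * s i := by
    intro i
    have := (P.beta_pos i).ne'
    rw [doubleEvolute_apply]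
    field_simp
    ring
  have h2 : ∑ i, P.alpha (i - 1) * (r i - r (i - 1)) * s i =
      ∑ i, P.alpha i * (r (i + 1) - r i) * s (i + 1) := by
    rw [← Equiv.sum_comp (Equiv.addRight (1 : ZMod (2 * n)))]
    simp
  simp only [h1, Finset.sum_sub_distrib, h2]
  rw [← Finset.sum_sub_distrib]
  exact Finset.sum_congr rfl fun i _ => by ring

theorem sum_doubleEvolute_mul_comm [NeZero n] (r s : ZMod (2 * n) → ℝ) :
    ∑ i, P.doubleEvolute r i * s i / P.beta i = ∑ i, P.doubleEvolute s i * r i / P.beta i := by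
  rw [sum_doubleEvolute_mul, sum_doubleEvolute_mul]
  exact Finset.sum_congr rfl fun i _ => by ring

theorem eq_zero_of_sum_sq [NeZero n] {r : ZMod (2 * n) → ℝ} (h : ∑ i, r i * r i / P.beta i = 0) :
    r = 0 := by
  rw [Finset.sum_eq_zero_iff_of_nonneg
    (fun i _ => div_nonneg (mul_self_nonneg _) (P.beta_pos i).le)] at h
  funext i
  simpa [(P.beta_pos i).ne'] using h i (Finset.mem_univ i)

/-- Conjugating by the diagonal matrix of `√β` turns self-adjointness for the weights `1/β` into
ordinary symmetry. -/
theorem splits_charpoly [NeZero n] : P.doubleEvolute.charpoly.Splits := by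
  set A := LinearMap.toMatrix' P.doubleEvolute with hA
  have hsymm : ∀ i j, A i j / P.beta i = A j i / P.beta j := by
    intro i j
    have := P.sum_doubleEvolute_mul_comm (Pi.single j 1) (Pi.single i 1)
    simpa [Pi.single_apply, ite_div, hA, LinearMap.toMatrix'_apply] using this
  let b : ZMod (2 * n) → ℝ := fun i => √(P.beta i)
  have hb : ∀ i, b i ≠ 0 := fun i => (Real.sqrt_pos.2 (P.beta_pos i)).ne'
  have hbb : ∀ i, b i * b i = P.beta i := fun i => Real.mul_self_sqrt (P.beta_pos i).le
  set M := Matrix.diagonal (fun i => (b i)⁻¹) * (A * Matrix.diagonal b) with hM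
  have hMA : M.charpoly = P.doubleEvolute.charpoly := by
    rw [hM, Matrix.charpoly_mul_comm, Matrix.mul_assoc, Matrix.diagonal_mul_diagonal]
    simp [hb, hA, ← LinearMap.toMatrix_eq_toMatrix']
  have hH : M.IsHermitian := by
    ext i j
    have h := hsymm i j
    have hi := hb i
    have hj := hb j
    rw [← hbb, ← hbb] at h
    simp only [hM, Matrix.conjTranspose_apply, Matrix.diagonal_mul, Matrix.mul_diagonal,
      star_trivial]
    field_simp at h ⊢
    linarith
  rw [← hMA]
  exact hH.splits_charpoly

theorem length_eigenvalueList [NeZero n] : P.eigenvalueList.length = 2 * n := by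
  rw [eigenvalueList, Multiset.length_sort, ← P.splits_charpoly.natDegree_eq_card_roots,
    LinearMap.charpoly_natDegree]
  simp [ZMod.card]

theorem eigenvalue_nonneg [NeZero n] {l : ℝ} (h : Module.End.HasEigenvalue P.doubleEvolute l) : 0 ≤ l := by
  obtain ⟨v, hv, hv0⟩ := h.exists_hasEigenvector
  have hTv := Module.End.mem_eigenspace_iff.1 hv
  have h1 := P.sum_doubleEvolute_mul v v
  have h2 : 0 ≤ ∑ i, P.alpha i * (v (i + 1) - v i) * (v (i + 1) - v i) :=
    Finset.sum_nonneg fun i _ => by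
      rw [mul_assoc]
      exact mul_nonneg (P.alpha_pos i).le (mul_self_nonneg _)
  have h3 : ∑ i, P.doubleEvolute v i * v i / P.beta i = l * ∑ i, v i * v i / P.beta i := by
    rw [hTv, Finset.mul_sum]
    exact Finset.sum_congr rfl fun i _ => by simp only [Pi.smul_apply, smul_eq_mul]; ring
  have h4 : 0 ≤ ∑ i, v i * v i / P.beta i :=
    Finset.sum_nonneg fun i _ => div_nonneg (mul_self_nonneg _) (P.beta_pos i).le
  have h5 : 0 < ∑ i, v i * v i / P.beta i :=
    lt_of_le_of_ne h4 fun h => hv0 (P.eq_zero_of_sum_sq h.symm)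
  rw [← h1, h3] at h2
  exact nonneg_of_mul_nonneg_left h2 h5

/-- For the self-adjoint `S = T_P - l`, `⟨S w, S w⟩ = ⟨w, S² w⟩`, so `S² w = 0` already gives `S w =
0`. -/
theorem maxGenEigenspace_eq [NeZero n] (l : ℝ) :
    Module.End.maxGenEigenspace P.doubleEvolute l = Module.End.eigenspace P.doubleEvolute l := by
  refine le_antisymm (fun v hv => ?_) Module.End.eigenspace_le_maxGenEigenspace
  obtain ⟨k, hk⟩ := (Module.End.mem_maxGenEigenspace _ _ _).1 hv
  set S := P.doubleEvolute - l • (1 : Module.End ℝ (ZMod (2 * n) → ℝ)) with hS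
  have hsymm : ∀ r s, ∑ i, S r i * s i / P.beta i = ∑ i, S s i * r i / P.beta i := by
    intro r s
    have : ∀ r s : ZMod (2 * n) → ℝ, ∑ i, S r i * s i / P.beta i =
        ∑ i, P.doubleEvolute r i * s i / P.beta i - l * ∑ i, r i * s i / P.beta i := by
      intro r s
      rw [Finset.mul_sum, ← Finset.sum_sub_distrib]
      exact Finset.sum_congr rfl fun i _ => by
        simp only [hS, LinearMap.sub_apply, LinearMap.smul_apply, Module.End.one_apply,
          Pi.sub_apply, Pi.smul_apply, smul_eq_mul]
        ring
    rw [this, this, sum_doubleEvolute_mul_comm]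
    simp only [mul_comm (r _)]
  have hsq : ∀ w, S (S w) = 0 → S w = 0 := by
    intro w hw
    apply P.eq_zero_of_sum_sq
    rw [hsymm w (S w), hw]
    simp
  have hpow : ∀ k : ℕ, ∀ w, (S ^ (k + 1)) w = 0 → S w = 0 := by
    intro k
    induction k with
    | zero => intro w hw; simpa using hw
    | succ k ih =>
      intro w hw
      rw [pow_succ, Module.End.mul_apply] at hw
      exact hsq _ (ih _ hw)
  have hv0 : S v = 0 := hpow k v (by rw [pow_succ', Module.End.mul_apply, hk, map_zero])
  rw [Module.End.mem_eigenspace_iff]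
  simpa [hS, sub_eq_zero] using hv0

theorem rootMultiplicity_charpoly [NeZero n] (l : ℝ) :
    P.doubleEvolute.charpoly.rootMultiplicity l =
      Module.finrank ℝ (Module.End.eigenspace P.doubleEvolute l) := by
  rw [← maxGenEigenspace_eq, LinearMap.finrank_maxGenEigenspace_eq]

/-! ### Transfer matrices -/

theorem step_of_mem_eigenspace {l : ℝ} {r : ZMod (2 * n) → ℝ}
    (h : r ∈ Module.End.eigenspace P.doubleEvolute l) (k : ZMod (2 * n)) :
    (P.stepMatrix l k).mulVec ![r (k - 1), r k] = ![r k, r (k + 1)] := by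
  have hk := congrFun (Module.End.mem_eigenspace_iff.1 h) k
  rw [doubleEvolute_apply, Pi.smul_apply, smul_eq_mul] at hk
  have ha := (P.alpha_pos k).ne'
  have hb := (P.beta_pos k).ne'
  ext i
  fin_cases i
  · simp [stepMatrix, Matrix.mulVec, dotProduct, Fin.sum_univ_two]
  · simp only [stepMatrix, Matrix.mulVec, dotProduct, Fin.sum_univ_two]
    simp
    field_simp
    linear_combination hk

theorem transferMatrix_mulVec {l : ℝ} {r : ZMod (2 * n) → ℝ}
    (h : r ∈ Module.End.eigenspace P.doubleEvolute l) (m : ℕ) :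
    (P.transferMatrix l m).mulVec ![r 1, r 2] = ![r (m + 1), r (m + 2)] := by
  induction m with
  | zero => simp [transferMatrix]
  | succ m ih =>
    rw [transferMatrix, ← Matrix.mulVec_mulVec, ih]
    have := P.step_of_mem_eigenspace h ((m + 2 : ℕ) : ZMod (2 * n))
    have e1 : ((m + 2 : ℕ) : ZMod (2 * n)) - 1 = m + 1 := by push_cast; ring
    have e2 : ((m + 2 : ℕ) : ZMod (2 * n)) = m + 2 := by push_cast; ring
    rw [e1, e2] at this
    rw [e2, this]
    push_cast
    congr 2 <;> ring_nf

theorem stepMatrix_add (l : ℝ) (k : ZMod (2 * n)) :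
    P.stepMatrix l (k + n) = P.stepMatrix l k := by
  have : k + (n : ZMod (2 * n)) - 1 = k - 1 + n := by ring
  simp only [stepMatrix, this, P.alpha_add, P.beta_add]

theorem transferMatrix_add (l : ℝ) (m : ℕ) :
    P.transferMatrix l (m + n) = P.transferMatrix l m * P.halfTurn l := by
  induction m with
  | zero => simp [transferMatrix, halfTurn]
  | succ m ih =>
    have e : ((m + n + 2 : ℕ) : ZMod (2 * n)) = ((m + 2 : ℕ) : ZMod (2 * n)) + n := by
      push_cast; ring
    rw [show m + 1 + n = m + n + 1 by ring, transferMatrix, ih, e, stepMatrix_add, transferMatrix,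
      Matrix.mul_assoc]

theorem halfTurn_sq_mulVec {l : ℝ} {r : ZMod (2 * n) → ℝ}
    (h : r ∈ Module.End.eigenspace P.doubleEvolute l) :
    (P.halfTurn l * P.halfTurn l).mulVec ![r 1, r 2] = ![r 1, r 2] := by
  have e := P.transferMatrix_mulVec h (n + n)
  have : ((n + n : ℕ) : ZMod (2 * n)) = 0 := by rw [← two_mul]; exact ZMod.natCast_self _
  rw [this, transferMatrix_add] at e
  simpa [halfTurn] using e

theorem det_transferMatrix (l : ℝ) (m : ℕ) :
    (P.transferMatrix l m).det = P.alpha 1 / P.alpha (m + 1) := by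
  induction m with
  | zero => simp [transferMatrix, (P.alpha_pos 1).ne']
  | succ m ih =>
    have e1 : ((m + 2 : ℕ) : ZMod (2 * n)) - 1 = m + 1 := by push_cast; ring
    have e2 : ((m + 2 : ℕ) : ZMod (2 * n)) = ((m + 1 : ℕ) : ZMod (2 * n)) + 1 := by
      push_cast; ring
    have h1 := (P.alpha_pos (m + 1)).ne'
    have h2 := (P.alpha_pos (((m + 1 : ℕ) : ZMod (2 * n)) + 1)).ne'
    rw [transferMatrix, Matrix.det_mul, ih, stepMatrix, Matrix.det_fin_two_of, e1, e2]
    field_simp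
    ring

theorem det_halfTurn (l : ℝ) : (P.halfTurn l).det = 1 := by
  rw [halfTurn, det_transferMatrix, add_comm, P.alpha_add, div_self (P.alpha_pos 1).ne']

/-- The values at `1` and `2` of a solution. -/
noncomputable def initialValues : (ZMod (2 * n) → ℝ) →ₗ[ℝ] (Fin 2 → ℝ) where
  toFun r := ![r 1, r 2]
  map_add' r s := by simp
  map_smul' c r := by simp

/-- A second-order recurrence is determined by two consecutive values; this bounds eigenspaces by
dimension 2. -/
theorem initialValues_injective [NeZero n] (l : ℝ) :
    Function.Injective
      ((initialValues (n := n)).comp (Module.End.eigenspace P.doubleEvolute l).subtype) := by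
  rw [← LinearMap.ker_eq_bot, LinearMap.ker_eq_bot']
  rintro ⟨r, hr⟩ h0
  have h0' : ![r 1, r 2] = 0 := h0
  have : r = 0 := by
    funext i
    have := congrFun (P.transferMatrix_mulVec hr (i - 1).val) 0
    rw [h0', Matrix.mulVec_zero] at this
    simpa using this.symm
  exact Subtype.ext this

theorem finrank_eigenspace_le_two [NeZero n] (l : ℝ) :
    Module.finrank ℝ (Module.End.eigenspace P.doubleEvolute l) ≤ 2 := by
  simpa using LinearMap.finrank_le_finrank_of_injective (P.initialValues_injective l)

theorem trace_sq_eq_four [NeZero n] {l : ℝ} (h : Module.End.HasEigenvalue P.doubleEvolute l) :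
    (P.halfTurn l).trace ^ 2 = 4 := by
  obtain ⟨r, hr, hr0⟩ := h.exists_hasEigenvector
  set H := P.halfTurn l with hH
  have hv : ![r 1, r 2] ≠ 0 := by
    intro h0
    have := P.initialValues_injective l (a₁ := ⟨r, hr⟩) (a₂ := 0) (by rw [map_zero]; exact h0)
    exact hr0 (congrArg Subtype.val this)
  have hdet : (H * H - 1).det = 0 := by
    refine Matrix.exists_mulVec_eq_zero_iff.1 ⟨_, hv, ?_⟩
    rw [Matrix.sub_mulVec, P.halfTurn_sq_mulVec hr, Matrix.one_mulVec, sub_self]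
  have h1 := P.det_halfTurn l
  rw [← hH, Matrix.det_fin_two] at h1
  rw [Matrix.det_fin_two] at hdet
  simp only [Matrix.sub_apply, Matrix.mul_apply, Fin.sum_univ_two, Matrix.one_apply_eq, ne_eq,
    zero_ne_one, one_ne_zero, not_false_eq_true, Matrix.one_apply_ne] at hdet
  rw [Matrix.trace_fin_two]
  -- For determinant 1, `det (H² - 1) = det (H - 1) det (H + 1) = (2 - tr H)(2 + tr H)`.
  linear_combination -hdet +
    (H 0 0 * H 1 1 - H 0 1 * H 1 0 + 3) * h1

theorem halfTurn_sq_eq_one [NeZero n] {l : ℝ}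
    (h : Module.finrank ℝ (Module.End.eigenspace P.doubleEvolute l) = 2) :
    P.halfTurn l * P.halfTurn l = 1 := by
  have hs := (LinearMap.injective_iff_surjective_of_finrank_eq_finrank (by simpa using h)).1
    (P.initialValues_injective l)
  refine Matrix.mulVec_injective (funext fun v => ?_)
  obtain ⟨⟨r, hr⟩, rfl⟩ := hs v
  rw [Matrix.one_mulVec]
  exact P.halfTurn_sq_mulVec hr

/-! ### The discriminant -/

/-- `stepMatrix` with polynomial entries. -/
noncomputable def stepPoly (k : ZMod (2 * n)) : Matrix (Fin 2) (Fin 2) ℝ[X] :=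
  !![0, 1;
     -C (P.alpha (k - 1) / P.alpha k),
       C (1 + P.alpha (k - 1) / P.alpha k) - C (1 / (P.alpha k * P.beta k)) * X]

/-- `transferMatrix` with polynomial entries. -/
noncomputable def transferPoly : ℕ → Matrix (Fin 2) (Fin 2) ℝ[X]
  | 0 => 1
  | m + 1 => P.stepPoly ((m + 2 : ℕ) : ZMod (2 * n)) * transferPoly m

theorem eval_transferPoly (l : ℝ) (m : ℕ) (i j : Fin 2) :
    (P.transferPoly m i j).eval l = P.transferMatrix l m i j := by
  induction m generalizing i j with
  | zero => fin_cases i <;> fin_cases j <;> simp [transferPoly, transferMatrix]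
  | succ m ih =>
    simp only [transferPoly, transferMatrix, Matrix.mul_apply, Fin.sum_univ_two, eval_add,
      eval_mul, ih]
    fin_cases i
    · simp [stepPoly, stepMatrix]
    · simp [stepPoly, stepMatrix]
      left
      ring

/-- The trace of the half-turn transform, as a polynomial. -/
noncomputable def discriminant : ℝ[X] := P.transferPoly n 0 0 + P.transferPoly n 1 1

theorem eval_discriminant (l : ℝ) : P.discriminant.eval l = (P.halfTurn l).trace := by
  rw [discriminant, eval_add, eval_transferPoly, eval_transferPoly, Matrix.trace_fin_two, halfTurn]

/-- Each step multiplies the lower right entry by a linear factor with leading coefficient `-1/(αβ)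
≠ 0`. The other entries are tracked to exclude cancellation; the `(0,0)` bound is not strict because
of the identity matrix at `m = 0`. -/
theorem degree_transferPoly (m : ℕ) :
    (P.transferPoly m 1 1).degree = m ∧ (P.transferPoly m 0 1).degree < m ∧
      (P.transferPoly m 1 0).degree < m ∧ (P.transferPoly m 0 0).degree ≤ m := by
  induction m with
  | zero => simp [transferPoly]
  | succ m ih =>
    obtain ⟨h11, h01, h10, h00⟩ := ih
    have hlt : (m : WithBot ℕ) < (m + 1 : ℕ) := by exact_mod_cast Nat.lt_succ_self m
    set k : ZMod (2 * n) := ((m + 2 : ℕ) : ZMod (2 * n))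
    set a := P.alpha (k - 1) / P.alpha k with ha
    have hc : -(1 / (P.alpha k * P.beta k)) ≠ 0 :=
      neg_ne_zero.2 (one_div_pos.2 (mul_pos (P.alpha_pos k) (P.beta_pos k))).ne'
    set c := -(1 / (P.alpha k * P.beta k))
    have hlin : (C c * X + C (1 + a)).degree = 1 := degree_linear hc
    have e0 : ∀ j, P.transferPoly (m + 1) 0 j = P.transferPoly m 1 j := by
      intro j
      simp [transferPoly, Matrix.mul_apply, stepPoly]
    have e1 : ∀ j, P.transferPoly (m + 1) 1 j =
        (C c * X + C (1 + a)) * P.transferPoly m 1 j - C a * P.transferPoly m 0 j := by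
      intro j
      rw [transferPoly, Matrix.mul_apply, Fin.sum_univ_two]
      simp only [stepPoly, Matrix.of_apply, Matrix.cons_val', Matrix.cons_val_zero,
        Matrix.cons_val_one, Matrix.cons_val_fin_one]
      simp only [c, C_neg]
      ring
    have hle : ∀ q : ℝ[X], (C a * q).degree ≤ q.degree := fun q => by
      simpa using (degree_mul_le (C a) q).trans (add_le_add_left degree_C_le _)
    refine ⟨?_, ?_, ?_, ?_⟩
    · have hd : ((C c * X + C (1 + a)) * P.transferPoly m 1 1).degree = ((m + 1 : ℕ) : WithBot ℕ) := by
        rw [degree_mul, hlin, h11, add_comm]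
        norm_cast
      rw [e1, degree_sub_eq_left_of_degree_lt, hd]
      rw [hd]
      exact ((hle _).trans_lt h01).trans hlt
    · rw [e0, h11]
      exact hlt
    · rw [e1]
      refine (degree_sub_le _ _).trans_lt (max_lt ?_ ((hle _).trans_lt (h00.trans_lt hlt)))
      rw [degree_mul, hlin, add_comm]
      rcases eq_or_ne (P.transferPoly m 1 0) 0 with h0 | h0
      · rw [h0]
        simp
      · rw [degree_eq_natDegree h0] at h10 ⊢
        norm_cast at h10 ⊢
        omega
    · rw [e0]
      exact (h10.trans hlt).le

theorem degree_trace_transferPoly (m : ℕ) :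
    (P.transferPoly (m + 1) 0 0 + P.transferPoly (m + 1) 1 1).degree = (m + 1 : ℕ) := by
  obtain ⟨h11, -, -, -⟩ := P.degree_transferPoly (m + 1)
  obtain ⟨-, -, h10, -⟩ := P.degree_transferPoly m
  have e0 : P.transferPoly (m + 1) 0 0 = P.transferPoly m 1 0 := by
    simp [transferPoly, Matrix.mul_apply, stepPoly]
  rw [degree_add_eq_right_of_degree_lt, h11]
  rw [h11, e0]
  refine h10.trans ?_
  exact_mod_cast Nat.lt_succ_self m

theorem degree_discriminant [NeZero n] : P.discriminant.degree = n := by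
  obtain ⟨m, hm⟩ := Nat.exists_eq_succ_of_ne_zero (NeZero.ne n)
  have := P.degree_trace_transferPoly m
  rwa [← Nat.succ_eq_add_one, ← hm] at this

/-- Here `H² = 1` and `det H = 1` force `H = ±1`; differentiating `det H = 1` at a scalar matrix
then kills the derivative of the trace. -/
theorem derivative_discriminant_eq_zero [NeZero n] {l : ℝ}
    (h : Module.finrank ℝ (Module.End.eigenspace P.doubleEvolute l) = 2) :
    (derivative P.discriminant).eval l = 0 := by
  have hdet : P.transferPoly n 0 0 * P.transferPoly n 1 1 -
      P.transferPoly n 0 1 * P.transferPoly n 1 0 = 1 := by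
    refine Polynomial.funext fun t => ?_
    have := P.det_halfTurn t
    rw [Matrix.det_fin_two] at this
    simpa [eval_transferPoly, halfTurn] using this
  have hder := congrArg (fun p => (derivative p).eval l) hdet
  simp only [derivative_sub, derivative_mul, eval_sub, eval_add, eval_mul, eval_transferPoly,
    derivative_one, eval_zero] at hder
  rw [discriminant, derivative_add, eval_add]
  have hsq := P.halfTurn_sq_eq_one h
  have hd := P.det_halfTurn l
  change P.transferMatrix l n * P.transferMatrix l n = 1 at hsq
  change (P.transferMatrix l n).det = 1 at hd
  rw [Matrix.det_fin_two] at hd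
  set H := P.transferMatrix l n
  have s00 := congrFun (congrFun hsq 0) 0
  have s01 := congrFun (congrFun hsq 0) 1
  have s10 := congrFun (congrFun hsq 1) 0
  have s11 := congrFun (congrFun hsq 1) 1
  simp only [Matrix.mul_apply, Fin.sum_univ_two, Matrix.one_apply_eq, ne_eq,
    zero_ne_one, one_ne_zero, not_false_eq_true, Matrix.one_apply_ne] at s00 s01 s10 s11
  have ht : H 0 0 + H 1 1 ≠ 0 := by
    intro h0
    have : H 1 1 = -H 0 0 := by linarith
    rw [this] at hd
    nlinarith
  have h01 : H 0 1 = 0 := by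
    have : H 0 1 * (H 0 0 + H 1 1) = 0 := by linarith
    exact (mul_eq_zero.1 this).resolve_right ht
  have h10 : H 1 0 = 0 := by
    have : H 1 0 * (H 0 0 + H 1 1) = 0 := by linarith
    exact (mul_eq_zero.1 this).resolve_right ht
  rw [h01, h10] at s00 s11 hd hder
  have heq : H 0 0 = H 1 1 := by
    have : (H 0 0 - H 1 1) ^ 2 = 0 := by nlinarith
    exact sub_eq_zero.1 (pow_eq_zero_iff (by norm_num) |>.1 this)
  rw [heq] at hder ht
  have h11 : H 1 1 ≠ 0 := by
    intro h0
    simp [h0] at ht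
  have : H 1 1 * ((derivative (P.transferPoly n 0 0)).eval l +
      (derivative (P.transferPoly n 1 1)).eval l) = 0 := by linarith
  exact (mul_eq_zero.1 this).resolve_left h11

end PolygonalBall

/-! ### The discriminant against the characteristic polynomial, and the eigenvalues of `H_l`. -/

theorem Matrix.hasEigenvalue_toLin'_fin_two_iff {K : Type*} [Field K] {A : Matrix (Fin 2) (Fin 2) K}
    (hA : A.det = 1) (z : K) :
    Module.End.HasEigenvalue (Matrix.toLin' A) z ↔ z ^ 2 - A.trace * z + 1 = 0 := by
  rw [Module.End.hasEigenvalue_iff_isRoot_charpoly, Matrix.charpoly_toLin', Matrix.charpoly_fin_two,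
    hA]
  simp [IsRoot]

theorem List.prod_map_eq_prod_range_getD {M : Type*} [CommMonoid M] (f : ℝ → M) (L : List ℝ) :
    (L.map f).prod = ∏ i ∈ Finset.range L.length, f (L.getD i 0) := by
  induction L with
  | nil => simp
  | cons a L ih => rw [List.length_cons, Finset.prod_range_succ', List.map_cons, List.prod_cons, ih]
                   simp [mul_comm]

namespace PolygonalBall

variable {n : ℕ} (P : PolygonalBall n)

theorem natDegree_discriminant [NeZero n] : P.discriminant.natDegree = n :=
  natDegree_eq_of_degree_eq_some P.degree_discriminant

theorem natDegree_discriminant_sq_sub [NeZero n] :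
    (P.discriminant ^ 2 - C 4).natDegree = 2 * n := by
  rw [natDegree_sub_C, natDegree_pow, natDegree_discriminant]

theorem discriminant_sq_sub_ne_zero [NeZero n] : P.discriminant ^ 2 - C 4 ≠ 0 := by
  intro h
  have := P.natDegree_discriminant_sq_sub
  rw [h, natDegree_zero] at this
  exact NeZero.ne n (by omega)

/-- Root multiplicities are compared: they equal eigenspace dimensions, so only 1 and 2 occur, and
in the second case `(D² - 4)' = 2 D D'` vanishes too. -/
theorem charpoly_dvd [NeZero n] : P.doubleEvolute.charpoly ∣ P.discriminant ^ 2 - C 4 := by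
  refine P.splits_charpoly.dvd_of_roots_le_roots P.doubleEvolute.charpoly_monic.ne_zero
    (Multiset.le_iff_count.2 fun l => ?_)
  rw [count_roots, count_roots]
  have hle := P.finrank_eigenspace_le_two l
  rw [← rootMultiplicity_charpoly] at hle
  rcases Nat.eq_zero_or_pos (P.doubleEvolute.charpoly.rootMultiplicity l) with h0 | hpos
  · rw [h0]
    exact Nat.zero_le _
  have hev : Module.End.HasEigenvalue P.doubleEvolute l := by
    rw [Module.End.hasEigenvalue_iff_isRoot_charpoly]
    exact (rootMultiplicity_pos P.doubleEvolute.charpoly_monic.ne_zero).1 hpos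
  have hroot : IsRoot (P.discriminant ^ 2 - C 4) l := by
    simp [IsRoot, eval_discriminant, P.trace_sq_eq_four hev]
  rcases (show P.doubleEvolute.charpoly.rootMultiplicity l = 1 ∨
    P.doubleEvolute.charpoly.rootMultiplicity l = 2 by omega) with h1 | h2
  · rw [h1]
    exact (rootMultiplicity_pos P.discriminant_sq_sub_ne_zero).2 hroot
  · rw [h2]
    refine (one_lt_rootMultiplicity_iff_isRoot P.discriminant_sq_sub_ne_zero).2 ⟨hroot, ?_⟩
    rw [rootMultiplicity_charpoly] at h2
    simp [IsRoot, derivative_pow, P.derivative_discriminant_eq_zero h2]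

theorem discriminant_sq_sub_eq [NeZero n] :
    P.discriminant ^ 2 - C 4 = C (P.discriminant.leadingCoeff ^ 2) * P.doubleEvolute.charpoly := by
  have h := eq_leadingCoeff_mul_of_monic_of_dvd_of_natDegree_le P.doubleEvolute.charpoly_monic
    P.charpoly_dvd (by
      rw [natDegree_discriminant_sq_sub, LinearMap.charpoly_natDegree]
      simp [ZMod.card])
  rwa [leadingCoeff_sub_of_degree_lt, leadingCoeff_pow] at h
  refine degree_lt_degree ?_
  rw [natDegree_C, natDegree_pow, natDegree_discriminant]
  exact mul_pos two_pos (Nat.pos_of_ne_zero (NeZero.ne n))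

theorem isDiscriminant [NeZero n] :
    IsDiscriminant n P.discriminant (P.discriminant.leadingCoeff ^ 2)
      (fun i => P.eigenvalueList.getD i 0) := by
  have hD0 : P.discriminant ≠ 0 := by
    intro h
    have := P.natDegree_discriminant
    rw [h, natDegree_zero] at this
    exact NeZero.ne n this.symm
  have hs : (P.discriminant ^ 2 - C 4).Splits := by
    rw [discriminant_sq_sub_eq]
    exact P.splits_charpoly.C_mul _
  have hf : P.discriminant ^ 2 - C 4 = (P.discriminant - C 2) * (P.discriminant + C 2) := by
    have : (C 4 : ℝ[X]) = C 2 * C 2 := by rw [← C_mul]; norm_num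
    rw [this]
    ring
  refine ⟨by rw [natDegree_discriminant]; exact NeZero.ne n,
    hs.of_dvd P.discriminant_sq_sub_ne_zero ⟨_, hf⟩,
    hs.of_dvd P.discriminant_sq_sub_ne_zero ⟨_, hf.trans (mul_comm _ _)⟩,
    sq_pos_of_ne_zero (leadingCoeff_ne_zero.2 hD0), fun i j hij hj => ?_, ?_⟩
  · rw [← P.length_eigenvalueList] at hj
    rw [List.getD_eq_getElem _ _ hj, List.getD_eq_getElem _ _ (hij.trans_lt hj)]
    rcases hij.eq_or_lt with rfl | hlt
    · exact le_rfl
    · exact List.pairwise_iff_getElem.1 (Multiset.pairwise_sort _ _) i j _ _ hlt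
  · have hp := List.prod_map_eq_prod_range_getD (fun a => X - C a) P.eigenvalueList
    rw [P.length_eigenvalueList] at hp
    rw [discriminant_sq_sub_eq, ← hp]
    congr 1
    rw [P.splits_charpoly.eq_prod_roots_of_monic P.doubleEvolute.charpoly_monic,
      ← Multiset.prod_coe, ← Multiset.map_coe, eigenvalueList, Multiset.sort_eq]

theorem eigenvalueList_nonneg [NeZero n] {i : ℕ} (hi : i < 2 * n) :
    0 ≤ P.eigenvalueList.getD i 0 := by
  rw [← P.length_eigenvalueList] at hi
  rw [List.getD_eq_getElem _ _ hi]
  apply P.eigenvalue_nonneg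
  rw [Module.End.hasEigenvalue_iff_isRoot_charpoly]
  exact isRoot_of_mem_roots ((Multiset.mem_sort _).1 (List.getElem_mem hi))

theorem isRealEigenvalue_iff (l μ : ℝ) :
    P.IsRealEigenvalue l μ ↔ μ ^ 2 - P.discriminant.eval l * μ + 1 = 0 := by
  rw [IsRealEigenvalue, Matrix.hasEigenvalue_toLin'_fin_two_iff (P.det_halfTurn l),
    eval_discriminant]

theorem isComplexEigenvalue_iff (l : ℝ) (z : ℂ) :
    P.IsComplexEigenvalue l z ↔ z ^ 2 - (P.discriminant.eval l : ℝ) * z + 1 = 0 := by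
  have hd : ((P.halfTurn l).map (algebraMap ℝ ℂ)).det = 1 := by
    rw [← RingHom.mapMatrix_apply, ← RingHom.map_det, P.det_halfTurn, map_one]
  rw [IsComplexEigenvalue, Matrix.hasEigenvalue_toLin'_fin_two_iff hd, eval_discriminant]
  simp [Matrix.trace_fin_two]

theorem exists_real_eigenvalues {l : ℝ} (h : 4 < P.discriminant.eval l ^ 2) :
    ∃ μ : ℝ, μ ≠ μ⁻¹ ∧ P.IsRealEigenvalue l μ ∧ P.IsRealEigenvalue l μ⁻¹ := by
  set d := P.discriminant.eval l with hd
  have hs : √(d ^ 2 - 4) ^ 2 = d ^ 2 - 4 := Real.sq_sqrt (by linarith)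
  have hs0 : 0 < √(d ^ 2 - 4) := Real.sqrt_pos.2 (by linarith)
  set s := √(d ^ 2 - 4)
  have hinv : ((d + s) / 2)⁻¹ = (d - s) / 2 := inv_eq_of_mul_eq_one_right (by linarith)
  refine ⟨(d + s) / 2, ?_, ?_, ?_⟩
  · rw [hinv]
    intro h
    linarith
  · rw [isRealEigenvalue_iff, ← hd]
    linarith
  · rw [hinv, isRealEigenvalue_iff, ← hd]
    linarith

/-- On the unit circle `z⁻¹` is the conjugate of `z`, so the trace `z + z⁻¹` is `2 Re z`. -/
theorem isComplexEigenvalue_iff_of_norm_eq_one (l : ℝ) {z : ℂ} (hz : ‖z‖ = 1) :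
    P.IsComplexEigenvalue l z ↔ P.discriminant.eval l = 2 * z.re := by
  have hz0 : z ≠ 0 := by
    rintro rfl
    simp at hz
  have hconj : z * (starRingEnd ℂ) z = 1 := by
    rw [Complex.mul_conj, Complex.normSq_eq_norm_sq, hz]
    simp
  have hre : z + (starRingEnd ℂ) z = (2 * z.re : ℝ) := Complex.add_conj z
  have key : z ^ 2 - (P.discriminant.eval l : ℝ) * z + 1 =
      z * ((2 * z.re : ℝ) - (P.discriminant.eval l : ℝ)) := by
    rw [← hre]
    linear_combination -hconj
  rw [isComplexEigenvalue_iff, key, mul_eq_zero, or_iff_right hz0, sub_eq_zero]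
  norm_cast
  exact eq_comm

theorem isComplexEigenvalue_iff_of_eq_cos {l t : ℝ} (h : P.discriminant.eval l = 2 * Real.cos t)
    (z : ℂ) : P.IsComplexEigenvalue l z ↔
      z = Complex.exp (t * Complex.I) ∨ z = Complex.exp (-(t * Complex.I)) := by
  have h1 : Complex.exp (t * Complex.I) * Complex.exp (-(t * Complex.I)) = 1 := by
    rw [← Complex.exp_add, add_neg_cancel, Complex.exp_zero]
  have h2 : ((P.discriminant.eval l : ℝ) : ℂ) =
      Complex.exp (t * Complex.I) + Complex.exp (-(t * Complex.I)) := by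
    rw [h, ← neg_mul, ← Complex.two_cos]
    push_cast
    rfl
  have key : z ^ 2 - (P.discriminant.eval l : ℝ) * z + 1 =
      (z - Complex.exp (t * Complex.I)) * (z - Complex.exp (-(t * Complex.I))) := by
    rw [h2]
    linear_combination -h1
  rw [isComplexEigenvalue_iff, key, mul_eq_zero, sub_eq_zero, sub_eq_zero]

end PolygonalBall

theorem mainTheorem5 (n : ℕ) [NeZero n] (P : PolygonalBall n) :
    -- the `2 n` eigenvalues of `T_P` are all real, so that they can be listed in increasing order
    P.eigenvalueList.length = 2 * n ∧
    -- (a)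
    (∀ k : ℕ, k < n →
      P.lambdaTwo k < P.lambdaOne (k + 1) ∧
      (∃ θ : ℝ → ℝ,
        ContinuousOn θ (Set.Icc (P.lambdaTwo k) (P.lambdaOne (k + 1))) ∧
        Set.BijOn θ (Set.Icc (P.lambdaTwo k) (P.lambdaOne (k + 1))) (Set.Icc 0 Real.pi) ∧
        Set.MapsTo θ (Set.Ioo (P.lambdaTwo k) (P.lambdaOne (k + 1))) (Set.Ioo 0 Real.pi) ∧
        ∀ l ∈ Set.Icc (P.lambdaTwo k) (P.lambdaOne (k + 1)), ∀ z : ℂ,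
          P.IsComplexEigenvalue l z ↔
            z = Complex.exp (θ l * Complex.I) ∨ z = Complex.exp (-(θ l * Complex.I))) ∧
      ∀ z : ℂ, ‖z‖ = 1 →
        ∃! l : ℝ, l ∈ Set.Icc (P.lambdaTwo k) (P.lambdaOne (k + 1)) ∧
          P.IsComplexEigenvalue l z) ∧
    -- (b)
    (∀ l : ℝ,
      (l < 0 ∨ ∃ k : ℕ, 1 ≤ k ∧ k ≤ n - 1 ∧ P.lambdaOne k < l ∧ l < P.lambdaTwo k) →
      ∃ μ : ℝ, μ ≠ μ⁻¹ ∧ P.IsRealEigenvalue l μ ∧ P.IsRealEigenvalue l μ⁻¹) := by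
  have h := P.isDiscriminant
  refine ⟨P.length_eigenvalueList, fun k hk => ?_, fun l hl => P.exists_real_eigenvalues ?_⟩
  -- In the zero-based list, band `k` runs from entry `2k` to entry `2k + 1`.
  · have e1 : P.lambdaOne (k + 1) = P.eigenvalueList.getD (2 * k + 1) 0 := by
      rw [PolygonalBall.lambdaOne]
      congr 1
    have e2 : P.lambdaTwo k = P.eigenvalueList.getD (2 * k) 0 := rfl
    rw [e1, e2]
    have hb := h.bijOn hk
    refine ⟨h.lt_succ hk, ⟨fun l => Real.arccos (P.discriminant.eval l / 2), ?_, ?_, ?_, ?_⟩, ?_⟩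
    · exact (Real.continuous_arccos.comp (P.discriminant.continuous.div_const 2)).continuousOn
    · refine ⟨fun l _ => ⟨Real.arccos_nonneg _, Real.arccos_le_pi _⟩, fun u hu v hv huv => ?_,
        fun t ht => ?_⟩
      · have hu' := hb.mapsTo hu
        have hv' := hb.mapsTo hv
        refine hb.injOn hu hv ?_
        have : P.discriminant.eval u / 2 = P.discriminant.eval v / 2 := Real.arccos_injOn ⟨by linarith [hu'.1], by linarith [hu'.2]⟩
          ⟨by linarith [hv'.1], by linarith [hv'.2]⟩ huv
        change P.discriminant.eval u = P.discriminant.eval v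
        linarith
      · obtain ⟨l, hl, hlt⟩ := hb.surjOn (show 2 * Real.cos t ∈ Set.Icc (-2) 2 from
          ⟨by linarith [Real.neg_one_le_cos t], by linarith [Real.cos_le_one t]⟩)
        refine ⟨l, hl, ?_⟩
        simp only at hlt ⊢
        rw [hlt, mul_div_cancel_left₀ _ two_ne_zero, Real.arccos_cos ht.1 ht.2]
    · intro l hl
      obtain ⟨ha, hb⟩ := abs_lt.1 (h.abs_lt_two hk hl.1 hl.2)
      refine ⟨Real.arccos_pos.2 (by linarith), lt_of_le_of_ne (Real.arccos_le_pi _) fun heq => ?_⟩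
      have := Real.arccos_eq_pi.1 heq
      linarith
    · intro l hl
      have hm := hb.mapsTo hl
      refine P.isComplexEigenvalue_iff_of_eq_cos ?_
      rw [Real.cos_arccos (by linarith [hm.1]) (by linarith [hm.2])]
      ring
    · intro z hz
      have hre := abs_le.1 ((Complex.abs_re_le_norm z).trans_eq hz)
      obtain ⟨l, hl, hlz⟩ := hb.surjOn (show 2 * z.re ∈ Set.Icc (-2) 2 from
          ⟨by linarith [hre.1], by linarith [hre.2]⟩)
      refine ⟨l, ⟨hl, (P.isComplexEigenvalue_iff_of_norm_eq_one l hz).2 hlz⟩, ?_⟩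
      rintro l' ⟨hl', hz'⟩
      exact hb.injOn hl' hl (((P.isComplexEigenvalue_iff_of_norm_eq_one l' hz).1 hz').trans
        hlz.symm)
  · rcases hl with hl | ⟨k, hk1, hkn, h1, h2⟩
    · exact h.four_lt_eval_sq_of_lt fun i hi => hl.trans_le (P.eigenvalueList_nonneg hi)
    · exact h.four_lt_eval_sq (by omega) hk1 h1 h2
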